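/- Let $q$ be a prime power, let $t\ge 1$ be an integer, and write $V_I=\{x\in\mathbf F_q^n : x_i=0 \text{ for } i\notin I\}$ for $I\subseteq\{1,\dots,n\}$. For linear codes $C_2\subseteq C_1\subseteq\mathbf F_q^n$ with $\dim C_1-\dim C_2\ge t$, the $t$-th relative generalized Hamming weight is $$M_t(C_1,C_2)=\min\{|I| : I\subseteq\{1,\dots,n\},\ \dim(C_1\cap V_I)-\dim(C_2\cap V_I)\ge t\}.$$ For real $R_1,R_2$ with $0\le R_1\le 1$ and $R_2\ge 0$ let $$\delta^0_q(t,R_1,R_2)=\limsup_{n\to\infty}\ \max\Big\{\tfrac dn : d\in\mathbf Z_{\ge 0},\ \text{there are linear codes } C_2\subseteq C_1\subseteq\mathbf F_q^n \text{ with } \dim C_1-\dim C_2\ge t,\ \dim C_1\ge nR_1,\ \dim C_2\le nR_2,\ M_t(C_1,C_2)\ge d\Big\},$$ (the set is non-empty for all $n\ge t$), and let $H_q(x)=-x\log_q x-(1-x)\log_q(1-x)$ for $0\le x\le 1$, with $0\log_q 0=0$. Theorem. 1. For all $0\le R_1\le 1$, $\ \delta^0_q(t,R_1,R_1)=1-R_1$.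 2. For all $0\le R_1\le 1$ and $R_2\ge 0$: every $\delta\in[0,1]$ that satisfies $$\delta\le 1-\frac{H_q(\delta)}{t}-R_1$$ satisfies $\delta^0_q(t,R_1,R_2)\ge\delta$. Moreover, the number $\delta=\delta^0_q(t,R_1,R_2)$ itself satisfies $$\delta\ge 1-\frac{H_q(\delta)}{t}-R_1 .$$ -/

import Mathlib

open Filter Module

namespace RGHW

variable {F : Type*} [Field F]

/-- The coordinate subspace `V_I` of `F^n`: the vectors that vanish outside `I`. -/
def coordSubspace (F : Type*) [Field F] {n : ℕ} (I : Finset (Fin n)) :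
    Submodule F (Fin n → F) where
  carrier := {x | ∀ i, i ∉ I → x i = 0}
  zero_mem' := fun _ _ => rfl
  add_mem' := by
    intro x y hx hy i hi
    simp [hx i hi, hy i hi]
  smul_mem' := by
    intro c x hx i hi
    simp [hx i hi]

/-- The `t`-th relative generalized Hamming weight `M_t(C₁, C₂)`: the least size of an index set
`I` with `dim (C₁ ∩ V_I) - dim (C₂ ∩ V_I) ≥ t`. For `C₂ ⊆ C₁` such an `I` exists exactly when
`t ≤ dim C₁ - dim C₂`, and the weight is used only in that case. -/
noncomputable def weight {n : ℕ} (t : ℕ) (C₁ C₂ : Submodule F (Fin n → F)) : ℕ :=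
  sInf {w : ℕ | ∃ I : Finset (Fin n), I.card = w ∧
    t + finrank F ↥(C₂ ⊓ coordSubspace F I) ≤ finrank F ↥(C₁ ⊓ coordSubspace F I)}

/-- The ratios `d / n` such that some nested pair `C₂ ⊆ C₁ ⊆ F^n` with `dim C₁ ≥ n R₁`,
`dim C₂ ≤ n R₂`, whose weight `M_t(C₁, C₂)` is defined (`t ≤ dim C₁ - dim C₂`),
satisfies `M_t(C₁, C₂) ≥ d`. -/
def ratios (F : Type*) [Field F] (t : ℕ) (R₁ R₂ : ℝ) (n : ℕ) : Set ℝ :=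
  {x | ∃ d : ℕ, x = (d : ℝ) / (n : ℝ) ∧
    ∃ C₁ C₂ : Submodule F (Fin n → F), C₂ ≤ C₁ ∧
      t + finrank F C₂ ≤ finrank F C₁ ∧
      (n : ℝ) * R₁ ≤ (finrank F C₁ : ℝ) ∧
      (finrank F C₂ : ℝ) ≤ (n : ℝ) * R₂ ∧
      d ≤ weight t C₁ C₂}

/-- The asymptotic metric `δ⁰_q(t, R₁, R₂)`, where `q` is the number of elements of `F`. For
`0 ≤ R₁ ≤ 1`, `0 ≤ R₂` and `n ≥ t` the supremum is a maximum, see `exists_isGreatest_ratios`. -/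
noncomputable def deltaZero (F : Type*) [Field F] (t : ℕ) (R₁ R₂ : ℝ) : ℝ :=
  limsup (fun n : ℕ => sSup (ratios F t R₁ R₂ n)) atTop

/-- The entropy function `H_q(x) = -x log_q x - (1 - x) log_q (1 - x)` (with `0 log 0 = 0`). -/
noncomputable def entropy (q : ℕ) (x : ℝ) : ℝ :=
  -x * Real.logb q x - (1 - x) * Real.logb q (1 - x)

theorem coordSubspace_univ {n : ℕ} :
    coordSubspace F (Finset.univ : Finset (Fin n)) = ⊤ := by
  ext x
  simp [coordSubspace]

theorem weight_le {n t : ℕ} {C₁ C₂ : Submodule F (Fin n → F)}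
    (h : t + finrank F C₂ ≤ finrank F C₁) : weight t C₁ C₂ ≤ n := by
  refine Nat.sInf_le ⟨Finset.univ, by simp, ?_⟩
  rw [coordSubspace_univ, inf_top_eq, inf_top_eq]
  exact h

theorem exists_isGreatest_ratios {t n : ℕ} {R₁ R₂ : ℝ} (hR₁ : R₁ ≤ 1) (hR₂ : 0 ≤ R₂)
    (hn : t ≤ n) : ∃ x, IsGreatest (ratios F t R₁ R₂ n) x := by
  have hfin : (ratios F t R₁ R₂ n).Finite := by
    refine ((Finset.range (n + 1)).finite_toSet.image
      (fun d : ℕ => (d : ℝ) / (n : ℝ))).subset ?_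
    rintro x ⟨d, rfl, C₁, C₂, -, h, -, -, hd⟩
    refine ⟨d, ?_, rfl⟩
    have := hd.trans (weight_le h)
    simpa using Nat.lt_succ_of_le this
  have hne : (ratios F t R₁ R₂ n).Nonempty := by
    refine ⟨0, 0, by simp, ⊤, ⊥, bot_le, by simpa using hn, ?_, ?_, Nat.zero_le _⟩
    · have h0 : (0 : ℝ) ≤ n := Nat.cast_nonneg n
      simpa using mul_le_of_le_one_right h0 hR₁
    · simpa using mul_nonneg (Nat.cast_nonneg n) hR₂
  obtain ⟨x, hx, hmax⟩ := hfin.exists_maximal hne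
  exact ⟨x, hx, fun y hy => (le_total y x).elim id (fun h => hmax hy h)⟩

end RGHW

/-! For part 1, the Singleton bound `weight_add_finrank_le` gives δ⁰ ≤ 1 - R₁. Equality comes from
an explicit pair over any field: a coordinate subspace `V_I` inside a larger `V_K` enlarged by the
all-ones vector (`exists_sub_le_weight`). To make up the full relative dimension, that vector must
be captured modulo `V_I`, which forces the support set to contain `Iᶜ`.

For part 2, take C₂ = 0. A union bound over all linear maps `F^n → F^m` yields a kernel meeting
every `V_I` with |I| = d in dimension less than t (`exists_code_finrank_inf_lt`). The entropy bound
on binomial coefficients turns the counting condition into g(d/n) < 1 - R₁ asymptotically, where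
g(x) = x + H_q(x)/t. Concavity and g(1) = 1 make g increasing where it is below 1, which leaves room
for rounding. The final inequality follows by continuity: if g(δ⁰) < 1 - R₁, some larger x would
still satisfy the criterion. -/

namespace RGHW

variable {F : Type*} [Field F]

/-! ### Dimension arguments: Singleton bound and an extremal pair -/

section Codes

variable {n t : ℕ}

theorem mem_coordSubspace {I : Finset (Fin n)} {x : Fin n → F} :
    x ∈ coordSubspace F I ↔ ∀ i, i ∉ I → x i = 0 := Iff.rfl

theorem coordSubspace_mono {I J : Finset (Fin n)} (h : I ⊆ J) :
    coordSubspace F I ≤ coordSubspace F J :=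
  fun _ hx i hi => hx i fun hI => hi (h hI)

theorem finrank_coordSubspace (I : Finset (Fin n)) :
    finrank F (coordSubspace F I) = I.card := by
  classical
  let f : (Fin n → F) →ₗ[F] ({i // i ∈ Iᶜ} → F) := LinearMap.funLeft F F Subtype.val
  have hf : Function.Surjective f :=
    LinearMap.funLeft_surjective_of_injective F F _ Subtype.val_injective
  have hker : LinearMap.ker f = coordSubspace F I := by
    ext x
    simp [f, mem_coordSubspace, funext_iff, LinearMap.funLeft_apply]
  have h := f.finrank_range_add_finrank_ker
  rw [LinearMap.range_eq_top.2 hf, finrank_top, hker] at h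
  simp only [finrank_fintype_fun_eq_card, Fintype.card_coe, Finset.card_compl,
    Fintype.card_fin] at h
  have := I.card_le_univ
  simp only [Fintype.card_fin] at this
  omega

/-- Every code `C` has a set of at most `dim C` coordinates on which only the zero codeword
vanishes. -/
theorem exists_card_le_finrank_inf_coordSubspace_compl (C : Submodule F (Fin n → F)) :
    ∃ J : Finset (Fin n), J.card ≤ finrank F C ∧ C ⊓ coordSubspace F Jᶜ = ⊥ := by
  induction h : finrank F C using Nat.strong_induction_on generalizing C with
  | _ k ih =>
    by_cases hC : C = ⊥
    · exact ⟨∅, by simp, by simp [hC]⟩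
    obtain ⟨x, hxC, hx⟩ := C.ne_bot_iff.1 hC
    obtain ⟨i, hi⟩ := Function.ne_iff.1 hx
    -- Some codeword is nonzero at `i`, so imposing `x i = 0` lowers the dimension and pays for
    -- adding `i` to `J`.
    let C' := C ⊓ LinearMap.ker (LinearMap.proj i : (Fin n → F) →ₗ[F] F)
    have hlt : finrank F C' < finrank F C := by
      refine Submodule.finrank_lt_finrank_of_lt (lt_of_le_of_ne inf_le_left fun h' => hi ?_)
      have : x ∈ C' := h' ▸ hxC
      exact this.2
    obtain ⟨J, hJ, hJC⟩ := ih _ (h ▸ hlt) C' rfl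
    refine ⟨insert i J, (Finset.card_insert_le _ _).trans (by omega), ?_⟩
    refine (Submodule.eq_bot_iff _).2 fun y hy => ?_
    have hyi : y i = 0 := hy.2 i (by simp)
    have : y ∈ C' ⊓ coordSubspace F Jᶜ :=
      ⟨⟨hy.1, hyi⟩, coordSubspace_mono (by simp [Finset.subset_iff]) hy.2⟩
    rwa [hJC, Submodule.mem_bot] at this

/-- The Singleton bound for relative generalized Hamming weights. -/
theorem weight_add_finrank_le {C₁ C₂ : Submodule F (Fin n → F)}
    (h : t + finrank F C₂ ≤ finrank F C₁) : weight t C₁ C₂ + finrank F C₁ ≤ n + t := by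
  have hn : finrank F C₁ ≤ n := by simpa using C₁.finrank_le
  obtain ⟨J, hJ, hJC⟩ := exists_card_le_finrank_inf_coordSubspace_compl C₂
  -- With this size, `C₁` and `V_{Kᶜ}` have dimensions summing to `n + t`, so they meet in dimension
  -- at least `t`, while `C₂` still meets `V_{Kᶜ}` trivially.
  obtain ⟨K, hJK, hK⟩ := Finset.exists_superset_card_eq (s := J) (n := finrank F C₁ - t)
    (by omega) (by simp; omega)
  have hcard : (Kᶜ).card = n + t - finrank F C₁ := by
    rw [Finset.card_compl, hK, Fintype.card_fin]; omega
  have hbot : C₂ ⊓ coordSubspace F Kᶜ = ⊥ :=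
    le_bot_iff.1 ((inf_le_inf_left _ (coordSubspace_mono (by simpa using hJK))).trans hJC.le)
  have hdim := Submodule.finrank_sup_add_finrank_inf_eq C₁ (coordSubspace F Kᶜ)
  have hsup : finrank F ↥(C₁ ⊔ coordSubspace F Kᶜ) ≤ n := by
    simpa using (C₁ ⊔ coordSubspace F Kᶜ).finrank_le
  rw [finrank_coordSubspace, hcard] at hdim
  have : weight t C₁ C₂ ≤ n + t - finrank F C₁ := by
    refine Nat.sInf_le ⟨Kᶜ, hcard, ?_⟩
    rw [hbot, finrank_bot]
    omega
  omega

theorem le_weight {C₁ C₂ : Submodule F (Fin n → F)} {d : ℕ}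
    (h : t + finrank F C₂ ≤ finrank F C₁)
    (hd : ∀ I : Finset (Fin n), t + finrank F ↥(C₂ ⊓ coordSubspace F I) ≤
      finrank F ↥(C₁ ⊓ coordSubspace F I) → d ≤ I.card) : d ≤ weight t C₁ C₂ := by
  -- Nonemptiness matters: `sInf ∅ = 0` in `ℕ`.
  refine le_csInf ⟨n, Finset.univ, by simp, ?_⟩ ?_
  · rwa [coordSubspace_univ, inf_top_eq, inf_top_eq]
  · rintro _ ⟨I, rfl, hI⟩
    exact hd I hI

/-- There are nested codes of dimensions `k` and `k + t` whose relative weight is at least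
`n - k`. -/
theorem exists_sub_le_weight (F : Type*) [Field F] {k : ℕ} (ht : 1 ≤ t) (hk : k + t ≤ n) :
    ∃ C₁ C₂ : Submodule F (Fin n → F), C₂ ≤ C₁ ∧ finrank F C₁ = k + t ∧ finrank F C₂ = k ∧
      n - k ≤ weight t C₁ C₂ := by
  obtain ⟨I, -, hI⟩ := Finset.exists_superset_card_eq (s := (∅ : Finset (Fin n))) (n := k)
    (by simp) (by simp; omega)
  obtain ⟨K, hIK, hK⟩ := Finset.exists_superset_card_eq (s := I) (n := k + t - 1)
    (by omega) (by simp; omega)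
  let e : Fin n → F := fun _ => 1
  let C₁ := coordSubspace F K ⊔ Submodule.span F {e}
  have hC₂ : finrank F (coordSubspace F I) = k := by rw [finrank_coordSubspace, hI]
  have hle : coordSubspace F I ≤ C₁ := (coordSubspace_mono hIK).trans le_sup_left
  have hC₁ : finrank F C₁ = k + t := by
    obtain ⟨j, hj⟩ : ∃ j, j ∉ K := by
      by_contra! hall
      have : K = Finset.univ := Finset.eq_univ_iff_forall.2 hall
      rw [this, Finset.card_univ, Fintype.card_fin] at hK
      omega
    have hinf : coordSubspace F K ⊓ Submodule.span F {e} = ⊥ := by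
      refine (Submodule.eq_bot_iff _).2 fun x hx => ?_
      obtain ⟨c, rfl⟩ := Submodule.mem_span_singleton.1 hx.2
      have : c * 1 = 0 := hx.1 j hj
      rw [mul_one] at this
      rw [this, zero_smul]
    have he : e ≠ 0 := fun h => one_ne_zero (congrFun h j)
    have h := Submodule.finrank_sup_add_finrank_inf_eq (coordSubspace F K) (Submodule.span F {e})
    rw [hinf, finrank_bot, finrank_coordSubspace, finrank_span_singleton he, hK] at h
    change finrank F C₁ + 0 = _ at h
    omega
  refine ⟨C₁, coordSubspace F I, hle, hC₁, hC₂, le_weight (by omega) fun A hA => ?_⟩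
  have hdim := Submodule.finrank_sup_add_finrank_inf_eq (C₁ ⊓ coordSubspace F A)
    (coordSubspace F I)
  have hcap : (C₁ ⊓ coordSubspace F A) ⊓ coordSubspace F I =
      coordSubspace F I ⊓ coordSubspace F A := by
    rw [inf_right_comm, inf_eq_right.2 hle]
  rw [hcap, hC₂] at hdim
  -- The hypothesis on `A` says that `C₁ ⊓ V_A` has dimension at least `t` modulo `V_I`, which is
  -- all of `C₁ / V_I`.
  have heq : (C₁ ⊓ coordSubspace F A) ⊔ coordSubspace F I = C₁ :=
    Submodule.eq_of_le_of_finrank_le (sup_le inf_le_left hle) (by omega)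
  have he : e ∈ (C₁ ⊓ coordSubspace F A) ⊔ coordSubspace F I := by
    rw [heq]
    exact (le_sup_right : _ ≤ C₁) (Submodule.mem_span_singleton_self e)
  obtain ⟨x, hx, c, hc, hxc⟩ := Submodule.mem_sup.1 he
  have hsub : Iᶜ ⊆ A := by
    intro j hj
    by_contra hjA
    have h1 : x j + c j = 1 := congrFun hxc j
    rw [hx.2 j hjA, hc j (Finset.mem_compl.1 hj), add_zero] at h1
    exact zero_ne_one h1
  have := Finset.card_le_card hsub
  rwa [Finset.card_compl, hI, Fintype.card_fin] at this

end Codes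

/-! ### Union bound over random linear maps -/

section Counting

variable {n t : ℕ}

/-- A linearly independent `t`-tuple is annihilated by a fraction `|W| ^ (-t)` of all linear maps
into `W`. -/
theorem card_annihilators_mul [Finite F] {V W : Type*} [AddCommGroup V] [Module F V]
    [AddCommGroup W] [Module F W] [Finite V] [Finite W] {v : Fin t → V}
    (hv : LinearIndependent F v) :
    Nat.card {f : V →ₗ[F] W // ∀ i, f (v i) = 0} * Nat.card W ^ t = Nat.card (V →ₗ[F] W) := by
  let ev : (V →ₗ[F] W) →ₗ[F] (Fin t → W) := LinearMap.pi fun i => LinearMap.applyₗ (v i)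
  -- Values on independent vectors can be prescribed on their span and extended, so the annihilators
  -- form the kernel of a surjection onto `W ^ t`.
  have hsurj : Function.Surjective ev := by
    intro w
    let b := Basis.span hv
    obtain ⟨g, hg⟩ := LinearMap.exists_extend (b.constr F w)
    refine ⟨g, funext fun i => ?_⟩
    have h := LinearMap.congr_fun hg (b i)
    rw [Basis.constr_basis, LinearMap.comp_apply, Submodule.subtype_apply, Basis.span_apply] at h
    exact h
  have h := Submodule.card_eq_card_quotient_mul_card (LinearMap.ker ev)
  rw [Nat.card_congr (ev.quotKerEquivOfSurjective hsurj).toEquiv, Nat.card_fun,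
    Nat.card_fin] at h
  rw [h]
  congr 1
  have hmem (f : V →ₗ[F] W) : (∀ i, f (v i) = 0) ↔ f ∈ LinearMap.ker ev := by
    simp [ev, LinearMap.mem_ker, funext_iff]
  exact Nat.card_congr (Equiv.subtypeEquivRight hmem)

/-- The Gilbert–Varshamov bound for generalized Hamming weights. -/
theorem exists_code_finrank_inf_lt [Fintype F] {m d : ℕ} (hm : m ≤ n)
    (h : n.choose d * Fintype.card F ^ (d * t) < Fintype.card F ^ (m * t)) :
    ∃ C : Submodule F (Fin n → F), n - m ≤ finrank F C ∧
      ∀ I : Finset (Fin n), I.card = d → finrank F ↥(C ⊓ coordSubspace F I) < t := by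
  classical
  let L := (Fin n → F) →ₗ[F] (Fin m → F)
  have : Finite L := Module.finite_of_finite F
  have : Fintype L := Fintype.ofFinite L
  let T (I : Finset (Fin n)) : Finset (Fin t → Fin n → F) :=
    Finset.univ.filter fun v => (∀ i, v i ∈ coordSubspace F I) ∧ LinearIndependent F v
  let K (v : Fin t → Fin n → F) : Finset L := Finset.univ.filter fun f => ∀ i, f (v i) = 0
  have hT (I : Finset (Fin n)) (hI : I.card = d) : (T I).card ≤ Fintype.card F ^ (d * t) := by
    have hV : Fintype.card (coordSubspace F I) = Fintype.card F ^ d := by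
      rw [Module.card_eq_pow_finrank (K := F), finrank_coordSubspace, hI]
    rw [pow_mul, ← hV]
    calc (T I).card ≤ (Finset.univ.image
          fun (w : Fin t → coordSubspace F I) i => (w i : Fin n → F)).card := by
          refine Finset.card_le_card fun v hv => ?_
          have hv := (Finset.mem_filter.1 hv).2.1
          exact Finset.mem_image.2 ⟨fun i => ⟨v i, hv i⟩, Finset.mem_univ _, rfl⟩
      _ ≤ _ := Finset.card_image_le
      _ = _ := by simp
  have hK (v : Fin t → Fin n → F) (hv : LinearIndependent F v) :
      (K v).card * Fintype.card F ^ (m * t) = Fintype.card L := by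
    have := card_annihilators_mul (W := Fin m → F) hv
    rw [Nat.card_fun, Nat.card_fin, ← pow_mul, Nat.card_eq_fintype_card (α := F),
      Nat.card_eq_fintype_card (α := (Fin n → F) →ₗ[F] (Fin m → F)),
      Nat.card_eq_fintype_card, Fintype.card_subtype] at this
    exact this
  -- The bad maps: those killing an independent `t`-tuple supported in some `d`-set.
  let B : Finset L := (Finset.powersetCard d Finset.univ).biUnion fun I => (T I).biUnion K
  have hq : 0 < Fintype.card F ^ (m * t) := pow_pos Fintype.card_pos _
  have hB : B.card * Fintype.card F ^ (m * t) ≤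
      n.choose d * Fintype.card F ^ (d * t) * Fintype.card L := by
    calc B.card * Fintype.card F ^ (m * t)
        ≤ (∑ I ∈ Finset.powersetCard d Finset.univ, ∑ v ∈ T I, (K v).card) *
            Fintype.card F ^ (m * t) := by
          refine Nat.mul_le_mul_right _ (Finset.card_biUnion_le.trans ?_)
          exact Finset.sum_le_sum fun I _ => Finset.card_biUnion_le
      _ = ∑ I ∈ Finset.powersetCard d Finset.univ, ∑ v ∈ T I, Fintype.card L := by
          simp_rw [Finset.sum_mul]
          refine Finset.sum_congr rfl fun I _ => Finset.sum_congr rfl fun v hv => ?_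
          exact hK v (Finset.mem_filter.1 hv).2.2
      _ ≤ ∑ I ∈ Finset.powersetCard d (Finset.univ : Finset (Fin n)),
            Fintype.card F ^ (d * t) * Fintype.card L := by
          refine Finset.sum_le_sum fun I hI => ?_
          rw [Finset.sum_const, smul_eq_mul]
          exact Nat.mul_le_mul_right _ (hT I (Finset.mem_powersetCard.1 hI).2)
      _ = _ := by
          rw [Finset.sum_const, Finset.card_powersetCard, Finset.card_univ, Fintype.card_fin,
            smul_eq_mul, mul_assoc]
  have hlt : B.card < Fintype.card L := by
    refine Nat.lt_of_mul_lt_mul_right (a := Fintype.card F ^ (m * t)) (hB.trans_lt ?_)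
    rw [mul_comm (Fintype.card L)]
    exact Nat.mul_lt_mul_of_pos_right h Fintype.card_pos
  obtain ⟨f, hf⟩ : ∃ f, f ∉ B := by
    by_contra! hall
    rw [Finset.eq_univ_iff_forall.2 hall, Finset.card_univ] at hlt
    exact hlt.false
  refine ⟨LinearMap.ker f, ?_, fun I hI => ?_⟩
  · have h := f.finrank_range_add_finrank_ker
    have h' : finrank F (LinearMap.range f) ≤ m := by
      simpa using (LinearMap.range f).finrank_le
    rw [finrank_fin_fun] at h
    omega
  · by_contra! hle
    obtain ⟨w, hw⟩ := exists_linearIndependent_of_le_finrank hle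
    let v : Fin t → Fin n → F := fun i => (w i : Fin n → F)
    have hv : LinearIndependent F v := hw.map' (Submodule.subtype _) (Submodule.ker_subtype _)
    refine hf (Finset.mem_biUnion.2 ⟨I, Finset.mem_powersetCard.2 ⟨Finset.subset_univ _, hI⟩,
      Finset.mem_biUnion.2 ⟨v, ?_, ?_⟩⟩)
    · exact Finset.mem_filter.2 ⟨Finset.mem_univ _, fun i => (w i).2.2, hv⟩
    · exact Finset.mem_filter.2 ⟨Finset.mem_univ _, fun i => (w i).2.1⟩

end Counting

/-! ### Entropy estimates -/

theorem entropy_eq_binEntropy_div_log (q : ℕ) (x : ℝ) :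
    entropy q x = Real.binEntropy x / Real.log q := by
  simp only [entropy, Real.binEntropy_eq_negMulLog_add_negMulLog_one_sub, Real.negMulLog,
    Real.logb]
  ring

theorem continuous_entropy (q : ℕ) : Continuous (entropy q) := by
  simp_rw [funext (entropy_eq_binEntropy_div_log q)]
  exact Real.binEntropy_continuous.div_const _

@[simp] theorem entropy_one (q : ℕ) : entropy q 1 = 0 := by
  simp [entropy_eq_binEntropy_div_log]

theorem concaveOn_entropy (q : ℕ) : ConcaveOn ℝ (Set.Icc 0 1) (entropy q) := by
  simp_rw [funext (entropy_eq_binEntropy_div_log q), div_eq_inv_mul]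
  exact Real.strictConcave_binEntropy.concaveOn.smul (c := (Real.log q)⁻¹)
    (inv_nonneg.2 (Real.log_natCast_nonneg q))

theorem log_choose_le_mul_binEntropy {n d : ℕ} (hd : d ≤ n) :
    Real.log (n.choose d) ≤ n * Real.binEntropy (d / n) := by
  rcases Nat.eq_zero_or_pos d with rfl | hd0
  · simp
  rcases hd.eq_or_lt with rfl | hlt
  · simp [hd0.ne']
  have hn : (0 : ℝ) < n := by exact_mod_cast hd0.trans hlt
  set x : ℝ := d / n with hx
  have hnx : n * x = d := by rw [hx]; field_simp
  have hx0 : 0 < x := div_pos (by exact_mod_cast hd0) hn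
  have hx1 : 0 < 1 - x := by
    rw [sub_pos, hx, div_lt_one hn]
    exact_mod_cast hlt
  have hC : (0 : ℝ) < n.choose d := by exact_mod_cast Nat.choose_pos hd
  -- A single term of the binomial expansion of `(x + (1 - x)) ^ n = 1`.
  have hle : x ^ d * (1 - x) ^ (n - d) * n.choose d ≤ 1 := by
    have h := add_pow x (1 - x) n
    rw [add_sub_cancel, one_pow] at h
    refine (Finset.single_le_sum
      (f := fun m => x ^ m * (1 - x) ^ (n - m) * (n.choose m : ℝ))
      (fun m _ => by positivity) (Finset.mem_range.2 (Nat.lt_succ_of_le hd))).trans h.ge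
  have hlog := Real.log_nonpos (by positivity) hle
  rw [Real.log_mul (by positivity) hC.ne', Real.log_mul (by positivity) (by positivity),
    Real.log_pow, Real.log_pow, Nat.cast_sub hd] at hlog
  rw [Real.binEntropy_eq_negMulLog_add_negMulLog_one_sub, Real.negMulLog, Real.negMulLog]
  have : n * (-x * Real.log x + -(1 - x) * Real.log (1 - x)) =
      -(d * Real.log x) - (n - d) * Real.log (1 - x) := by
    rw [← hnx]; ring
  rw [this]
  linarith

/-- The number of `d`-subsets of an `n`-set is at most `q ^ (n H_q(d / n))`. -/
theorem choose_le_rpow_entropy {q n d : ℕ} (hq : 2 ≤ q) (hd : d ≤ n) :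
    (n.choose d : ℝ) ≤ (q : ℝ) ^ (n * entropy q (d / n)) := by
  have hlq : 0 < Real.log q := Real.log_pos (by exact_mod_cast hq)
  have hC : (0 : ℝ) < n.choose d := by exact_mod_cast Nat.choose_pos hd
  have hq0 : (0 : ℝ) < q := by positivity
  rw [Real.le_rpow_iff_log_le hC hq0, entropy_eq_binEntropy_div_log]
  convert log_choose_le_mul_binEntropy hd using 1
  field_simp

/-- The function `x + H_q(x) / t` is concave with value `1` at `1`, so below a point where its
value is less than `1` it increases. -/
theorem add_entropy_div_lt (q : ℕ) {t x y : ℝ} (ht : 0 ≤ t) (hx : 0 ≤ x) (hxy : x < y)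
    (hy : y ≤ 1) (h : y + entropy q y / t < 1) :
    x + entropy q x / t < y + entropy q y / t := by
  by_contra! hle
  have hg : ConcaveOn ℝ (Set.Icc 0 1) fun z => z + entropy q z / t := by
    simp_rw [div_eq_inv_mul]
    exact (concaveOn_id (convex_Icc 0 1)).add ((concaveOn_entropy q).smul (inv_nonneg.2 ht))
  have hy1 : y < 1 := hy.lt_of_ne fun h1 => by simp [h1] at h
  have hc : 0 < 1 - x := by linarith
  -- `y` is a convex combination of `x` and `1` with positive weight on `1`, where the function
  -- exceeds its value at `y`.
  have hz : ((1 - y) / (1 - x)) • x + ((y - x) / (1 - x)) • (1 : ℝ) = y := by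
    simp only [smul_eq_mul]; field_simp; ring
  have ha : 0 ≤ (1 - y) / (1 - x) := by apply div_nonneg <;> linarith
  have hb : 0 < (y - x) / (1 - x) := by apply div_pos <;> linarith
  have hab : (1 - y) / (1 - x) + (y - x) / (1 - x) = 1 := by field_simp; ring
  have hx1 : x ∈ Set.Icc (0 : ℝ) 1 := ⟨hx, by linarith⟩
  have h1 : (1 : ℝ) ∈ Set.Icc (0 : ℝ) 1 := ⟨zero_le_one, le_rfl⟩
  have := hg.2 hx1 h1 ha hb.le hab
  simp only [hz] at this
  simp only [smul_eq_mul, entropy_one, zero_div, add_zero, mul_one] at this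
  nlinarith

/-! ### Passage to the limit superior -/

section Asymptotics

variable {n t : ℕ} {R₁ R₂ : ℝ}

theorem le_of_mem_ratios (hn : 0 < n) {x : ℝ} (hx : x ∈ ratios F t R₁ R₂ n) :
    x ≤ 1 - R₁ + t / n := by
  obtain ⟨d, rfl, C₁, C₂, -, h, hR, -, hd⟩ := hx
  have hn' : (0 : ℝ) < n := by exact_mod_cast hn
  have h1 : (d : ℝ) + finrank F C₁ ≤ n + t := by
    exact_mod_cast (Nat.add_le_add_right hd _).trans (weight_add_finrank_le h)
  have h2 : 1 - R₁ + t / n = (n - n * R₁ + t) / n := by field_simp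
  rw [h2]
  gcongr
  linarith

theorem le_one_of_mem_ratios {x : ℝ} (hx : x ∈ ratios F t R₁ R₂ n) : x ≤ 1 := by
  obtain ⟨d, rfl, C₁, C₂, -, h, -, -, hd⟩ := hx
  exact div_le_one_of_le₀ (by exact_mod_cast hd.trans (weight_le h)) (Nat.cast_nonneg n)

theorem bddAbove_ratios : BddAbove (ratios F t R₁ R₂ n) :=
  ⟨1, fun _ => le_one_of_mem_ratios⟩

theorem sSup_ratios_nonneg : 0 ≤ sSup (ratios F t R₁ R₂ n) := by
  refine Real.sSup_nonneg ?_
  rintro _ ⟨d, rfl, -⟩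
  positivity

theorem sSup_ratios_le_one : sSup (ratios F t R₁ R₂ n) ≤ 1 :=
  Real.sSup_le (fun _ => le_one_of_mem_ratios) zero_le_one

theorem isBoundedUnder_le_sSup_ratios :
    IsBoundedUnder (· ≤ ·) atTop fun n : ℕ => sSup (ratios F t R₁ R₂ n) :=
  isBoundedUnder_of ⟨1, fun _ => sSup_ratios_le_one⟩

theorem isCoboundedUnder_le_sSup_ratios :
    IsCoboundedUnder (· ≤ ·) atTop fun n : ℕ => sSup (ratios F t R₁ R₂ n) :=
  (isBoundedUnder_of ⟨0, fun _ => sSup_ratios_nonneg⟩ :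
    IsBoundedUnder (· ≥ ·) atTop fun n : ℕ => sSup (ratios F t R₁ R₂ n)).isCoboundedUnder_le

theorem le_deltaZero_of_eventually {c : ℝ}
    (h : ∀ᶠ n : ℕ in atTop, ∃ x ∈ ratios F t R₁ R₂ n, c ≤ x) : c ≤ deltaZero F t R₁ R₂ := by
  refine le_limsup_of_frequently_le (Eventually.frequently ?_) isBoundedUnder_le_sSup_ratios
  filter_upwards [h] with n ⟨x, hx, hcx⟩
  exact hcx.trans (le_csSup bddAbove_ratios hx)

theorem deltaZero_nonneg : 0 ≤ deltaZero F t R₁ R₂ :=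
  le_limsup_of_frequently_le (Frequently.of_forall fun _ => sSup_ratios_nonneg)
    isBoundedUnder_le_sSup_ratios

theorem deltaZero_le_one : deltaZero F t R₁ R₂ ≤ 1 :=
  limsup_le_of_le isCoboundedUnder_le_sSup_ratios (Eventually.of_forall fun _ => sSup_ratios_le_one)

theorem deltaZero_le (hR₁ : R₁ ≤ 1) : deltaZero F t R₁ R₂ ≤ 1 - R₁ := by
  have hlim : Tendsto (fun n : ℕ => 1 - R₁ + (t : ℝ) / n) atTop (nhds (1 - R₁)) := by
    simpa using (tendsto_const_div_atTop_nhds_zero_nat (t : ℝ)).const_add (1 - R₁)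
  rw [← hlim.limsup_eq]
  refine limsup_le_limsup ?_ isCoboundedUnder_le_sSup_ratios hlim.isBoundedUnder_le
  filter_upwards [eventually_gt_atTop 0] with n hn
  exact Real.sSup_le (fun _ => le_of_mem_ratios hn)
    -- The bound must be nonnegative because `sSup ∅ = 0` when no codes exist.
    (add_nonneg (sub_nonneg.2 hR₁) (by positivity))

theorem one_sub_le_deltaZero (ht : 1 ≤ t) (h0 : 0 ≤ R₁) (h1 : R₁ ≤ 1) (h12 : R₁ ≤ R₂) :
    1 - R₁ ≤ deltaZero F t R₁ R₂ := by
  refine le_deltaZero_of_eventually ?_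
  filter_upwards [eventually_gt_atTop t] with n hn
  have hn' : (0 : ℝ) < n := by exact_mod_cast (Nat.zero_le t).trans_lt hn
  -- The cap `n - t` keeps `k + t ≤ n` when `R₁` is near `1`.
  set k := min ⌊n * R₁⌋₊ (n - t) with hk
  have hkR : (k : ℝ) ≤ n * R₁ :=
    (Nat.cast_le.2 (min_le_left _ _)).trans (Nat.floor_le (by positivity))
  have hRk : n * R₁ ≤ ((k + t : ℕ) : ℝ) := by
    rcases min_cases ⌊n * R₁⌋₊ (n - t) with ⟨h, -⟩ | ⟨h, -⟩
    · have h3 := Nat.lt_floor_add_one (n * R₁)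
      have h4 : (1 : ℝ) ≤ t := by exact_mod_cast ht
      rw [hk, h]
      push_cast
      linarith
    · rw [hk, h, Nat.sub_add_cancel hn.le]
      nlinarith
  have hkt : k + t ≤ n := by
    have : k ≤ n - t := min_le_right _ _
    omega
  obtain ⟨C₁, C₂, hle, hC₁, hC₂, hw⟩ := exists_sub_le_weight F ht hkt
  refine ⟨_, ⟨n - k, rfl, C₁, C₂, hle, by omega, by rwa [hC₁], ?_, hw⟩, ?_⟩
  · rw [hC₂]
    exact hkR.trans (by gcongr)
  · rw [le_div_iff₀ hn', Nat.cast_sub (by omega)]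
    linarith

theorem le_deltaZero_of_add_entropy_lt [Fintype F] (ht : 1 ≤ t) (hR₁ : 0 < R₁) (hR₂ : 0 ≤ R₂)
    {c δ : ℝ} (hc : 0 ≤ c) (hcδ : c < δ) (hδ1 : δ ≤ 1)
    (hδ : δ + entropy (Fintype.card F) δ / t ≤ 1 - R₁) : c ≤ deltaZero F t R₁ R₂ := by
  have ht' : (0 : ℝ) < t := by exact_mod_cast ht
  set q := Fintype.card F with hqdef
  have hq : 2 ≤ q := Fintype.one_lt_card
  have hq1 : (1 : ℝ) < q := by exact_mod_cast hq
  set g : ℝ → ℝ := fun x => x + entropy q x / t with hg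
  -- The gap `c < y` absorbs rounding in `d`, and `g y < 1 - R₁` absorbs rounding in `k`.
  obtain ⟨y, hcy, hyδ⟩ := exists_between hcδ
  have hgy : g y < 1 - R₁ :=
    (add_entropy_div_lt q ht'.le (hc.trans hcy.le) hyδ hδ1 (by linarith)).trans_le hδ
  have hlim := tendsto_natCast_atTop_atTop (R := ℝ)
  have e1 : ∀ᶠ n : ℕ in atTop, 1 < n * (y - c) :=
    (hlim.atTop_mul_const (sub_pos.2 hcy)).eventually_gt_atTop 1
  have e2 : ∀ᶠ n : ℕ in atTop, 1 < n * (1 - R₁ - g y) :=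
    (hlim.atTop_mul_const (sub_pos.2 hgy)).eventually_gt_atTop 1
  -- This ensures `t ≤ k`, so the weight is defined; it needs `R₁ > 0`.
  have e3 : ∀ᶠ n : ℕ in atTop, (t : ℝ) < n * R₁ :=
    (hlim.atTop_mul_const hR₁).eventually_gt_atTop _
  refine le_deltaZero_of_eventually ?_
  filter_upwards [eventually_gt_atTop 0, e1, e2, e3] with n hn hn1 hn2 hn3
  have hn' : (0 : ℝ) < n := by exact_mod_cast hn
  set d := ⌈n * c⌉₊ with hd
  set k := ⌈n * R₁⌉₊ with hk
  have hcd : c ≤ (d : ℝ) / n := by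
    rw [le_div_iff₀ hn', mul_comm]
    exact Nat.le_ceil _
  have hdy : (d : ℝ) / n < y := by
    rw [div_lt_iff₀ hn']
    have := Nat.ceil_lt_add_one (mul_nonneg hn'.le hc)
    linarith
  have hgd : g (d / n) < 1 - R₁ :=
    (add_entropy_div_lt q ht'.le (hc.trans hcd) (hdy.trans hyδ) hδ1 (by linarith)).trans_le hδ
  have hgdy : g (d / n) < g y :=
    add_entropy_div_lt q ht'.le (hc.trans hcd) hdy (hyδ.le.trans hδ1) (by
      change g y < 1
      linarith)
  have hdn : d ≤ n := by
    have : (d : ℝ) / n ≤ 1 := by linarith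
    exact_mod_cast (div_le_one hn').1 this
  have hkle : (k : ℝ) < n * R₁ + 1 := Nat.ceil_lt_add_one (by positivity)
  have hRk : n * R₁ ≤ k := Nat.le_ceil _
  have htk : t ≤ k := by exact_mod_cast (hn3.trans_le hRk).le
  have hR1 : R₁ ≤ 1 := by
    have : 0 ≤ g y := by
      have h0 : 0 ≤ entropy q y := by
        rw [entropy_eq_binEntropy_div_log]
        exact div_nonneg (Real.binEntropy_nonneg (hc.trans hcy.le) (hyδ.le.trans hδ1))
          (Real.log_natCast_nonneg q)
      have : 0 ≤ entropy q y / t := by positivity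
      change 0 ≤ y + entropy q y / t
      linarith
    linarith
  have hkn : k ≤ n := Nat.ceil_le.2 (by nlinarith)
  have hcount : n.choose d * q ^ (d * t) < q ^ ((n - k) * t) := by
    have hexp : n * entropy q (d / n) + d * t < (n - k) * t := by
      have h1 : n * entropy q (d / n) + d * t = n * g (d / n) * t := by
        simp only [hg]; field_simp; ring
      rw [h1]
      gcongr
      nlinarith
    have : (n.choose d : ℝ) * q ^ (d * t) < q ^ ((n - k) * t) := by
      calc (n.choose d : ℝ) * (q : ℝ) ^ (d * t)
          ≤ (q : ℝ) ^ (n * entropy q (d / n)) * (q : ℝ) ^ ((d : ℝ) * t) := by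
            rw [← Nat.cast_mul d t, Real.rpow_natCast]
            gcongr
            exact choose_le_rpow_entropy hq hdn
        _ = (q : ℝ) ^ (n * entropy q (d / n) + d * t) := by
            rw [Real.rpow_add (by linarith)]
        _ < (q : ℝ) ^ (((n : ℝ) - k) * t) := Real.rpow_lt_rpow_of_exponent_lt hq1 hexp
        _ = (q : ℝ) ^ ((n - k) * t) := by
            rw [← Nat.cast_sub hkn, ← Nat.cast_mul, Real.rpow_natCast]
    exact_mod_cast this
  obtain ⟨C, hC, hCI⟩ := exists_code_finrank_inf_lt (F := F) (Nat.sub_le n k) hcount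
  have hkC : k ≤ finrank F C := by omega
  have htC : t + finrank F (⊥ : Submodule F (Fin n → F)) ≤ finrank F C := by
    rw [finrank_bot]; omega
  refine ⟨_, ⟨d, rfl, C, ⊥, bot_le, htC, hRk.trans (by exact_mod_cast hkC), ?_, ?_⟩, hcd⟩
  · rw [finrank_bot, Nat.cast_zero]
    positivity
  · refine le_weight htC fun I hI => ?_
    by_contra! hlt
    -- The code bound concerns sets of size exactly `d`; smaller sets are enlarged.
    obtain ⟨J, hIJ, hJ⟩ := Finset.exists_superset_card_eq hlt.le (by simpa using hdn)
    have h1 := hCI J hJ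
    have h2 : finrank F ↥(C ⊓ coordSubspace F I) ≤ finrank F ↥(C ⊓ coordSubspace F J) :=
      Submodule.finrank_mono (inf_le_inf_left _ (coordSubspace_mono hIJ))
    omega

/-- The Gilbert–Varshamov bound for the asymptotic metric. -/
theorem le_deltaZero [Fintype F] (ht : 1 ≤ t) (hR₁ : 0 ≤ R₁) (hR₁' : R₁ ≤ 1) (hR₂ : 0 ≤ R₂)
    {δ : ℝ} (hδ1 : δ ≤ 1) (hδ : δ + entropy (Fintype.card F) δ / t ≤ 1 - R₁) :
    δ ≤ deltaZero F t R₁ R₂ := by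
  -- At `R₁ = 0` the explicit pair already gives the value `1`.
  rcases hR₁.eq_or_lt with rfl | hpos
  · have := one_sub_le_deltaZero (F := F) ht le_rfl hR₁' hR₂
    linarith
  refine le_of_forall_lt_imp_le_of_dense fun c hc => ?_
  rcases lt_or_ge c 0 with h | h
  · exact h.le.trans deltaZero_nonneg
  · exact le_deltaZero_of_add_entropy_lt ht hpos hR₂ h hc hδ1 hδ

theorem one_sub_le_deltaZero_add_entropy [Fintype F] (ht : 1 ≤ t) (hR₁ : 0 ≤ R₁) (hR₁' : R₁ ≤ 1)
    (hR₂ : 0 ≤ R₂) : 1 - R₁ ≤ deltaZero F t R₁ R₂ +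
      entropy (Fintype.card F) (deltaZero F t R₁ R₂) / t := by
  by_contra! hlt
  set D := deltaZero F t R₁ R₂ with hD
  have hD1 : D < 1 := deltaZero_le_one.lt_of_ne fun h => by
    rw [hD, h, entropy_one] at hlt
    linarith [zero_div (t : ℝ)]
  have hcont : Continuous fun x => x + entropy (Fintype.card F) x / t :=
    continuous_id.add ((continuous_entropy _).div_const _)
  have hev : ∀ᶠ x in nhds D, x + entropy (Fintype.card F) x / t < 1 - R₁ ∧ x < 1 :=
    (hcont.tendsto D |>.eventually_lt_const hlt).and (eventually_lt_nhds hD1)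
  obtain ⟨x, ⟨hx, hx1⟩, hDx⟩ :=
    ((hev.filter_mono nhdsWithin_le_nhds).and (self_mem_nhdsWithin (s := Set.Ioi D))).exists
  exact (le_deltaZero ht hR₁ hR₁' hR₂ hx1.le hx.le).not_gt hDx

end Asymptotics

end RGHW

theorem mainTheorem4 (F : Type*) [Field F] [Fintype F] (t : ℕ) (ht : 1 ≤ t) :
    (∀ R₁ : ℝ, 0 ≤ R₁ → R₁ ≤ 1 → RGHW.deltaZero F t R₁ R₁ = 1 - R₁) ∧
    (∀ R₁ R₂ : ℝ, 0 ≤ R₁ → R₁ ≤ 1 → 0 ≤ R₂ →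
      (∀ δ : ℝ, 0 ≤ δ → δ ≤ 1 →
        δ ≤ 1 - RGHW.entropy (Fintype.card F) δ / t - R₁ →
        δ ≤ RGHW.deltaZero F t R₁ R₂) ∧
      1 - RGHW.entropy (Fintype.card F) (RGHW.deltaZero F t R₁ R₂) / t - R₁ ≤
        RGHW.deltaZero F t R₁ R₂) := by
  refine ⟨fun R₁ h0 h1 => le_antisymm (RGHW.deltaZero_le h1)
    (RGHW.one_sub_le_deltaZero ht h0 h1 le_rfl), fun R₁ R₂ h0 h1 h2 => ⟨fun δ _ hδ1 hδ => ?_, ?_⟩⟩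
  · exact RGHW.le_deltaZero ht h0 h1 h2 hδ1 (by linarith)
  · linarith [RGHW.one_sub_le_deltaZero_add_entropy (F := F) ht h0 h1 h2]
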